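/- Let $(\Omega,\mathcal F,\mathbb P)$ be a complete probability space and let $\gamma=(\gamma_t)_{t\ge 0}$ be a standard gamma process on it, that is, a subordinator (stationary independent increments, almost surely nondecreasing càdlàg paths, $\gamma_0=0$) with $\mathbb E[e^{-\lambda\gamma_t}]=(1+\lambda)^{-t}$ for all $\lambda,t\ge 0$. Let $\tau:\Omega\to(0,\infty)$ be a random time independent of $\gamma$. Define the gamma bridge of random length $\tau$ and the process $Z$ by $$\zeta_t=\frac{\gamma_{t\wedge\tau}}{\gamma_\tau},\qquad Z_t=\frac{1-\zeta_t}{\tau-t}\,\mathbb I_{\{t<\tau\}},\qquad t\ge 0.$$ Let $\mathcal F^{\zeta,c}_t=\sigma(\zeta_s,\,s\le t)\vee\mathcal N_{\mathbb P}$, where $\mathcal N_{\mathbb P}$ is the collection of $\mathbb P$-null sets, and let $\mathcal H_t=\mathcal F^{\zeta,c}_t\vee\sigma(\tau)$. Then: (i) For every $t\ge 0$, $Z$ is integrable on $\Omega\times(0,t]$ with respect to $\mathbb P\otimes ds$, and $$\mathbb E\left[\int_0^t |Z_s|\,ds\right]\le 1<+\infty.$$ In particular, almost surely, $s\mapsto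 Z_s$ is integrable on $[0,t]$ for all $t\ge 0$. (ii) The random time $\tau$ is an $(\mathcal H_t)$-stopping time, and the process $$\widehat N_t=\zeta_t-\int_0^t Z_s\,ds,\qquad t\ge 0,$$ is an $(\mathcal H_t)_{t\ge 0}$-martingale stopped at $\tau$, that is, it is a martingale with respect to $(\mathcal H_t)_{t\ge0}$ and $\widehat N_t=\widehat N_{t\wedge\tau}$ for all $t\ge 0$. -/

import Mathlib

open MeasureTheory ProbabilityTheory Filter Topology
open scoped NNReal ENNReal

namespace GammaBridge

/-- A standard gamma process `(γ t, t ≥ 0)` on `(Ω, P)`: a subordinator (a process starting at `0`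
with stationary independent increments and, almost surely, nondecreasing càdlàg paths) whose
Laplace transform is `E[exp (-l * γ t)] = (1 + l) ^ (-t)` for `l ≥ 0`. -/
structure IsStandardGammaProcess {Ω : Type*} [MeasurableSpace Ω] (γ : ℝ≥0 → Ω → ℝ)
    (P : Measure Ω) : Prop where
  measurable : ∀ t, Measurable (γ t)
  start_zero : ∀ᵐ ω ∂P, γ 0 ω = 0
  indep_increments : HasIndepIncrements γ P
  stationary_increments : ∀ s t : ℝ≥0, IdentDistrib (fun ω => γ (s + t) ω - γ s ω) (γ t) P P
  monotone_paths : ∀ᵐ ω ∂P, Monotone fun t => γ t ω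
  right_continuous : ∀ᵐ ω ∂P, ∀ t, ContinuousWithinAt (fun s => γ s ω) (Set.Ici t) t
  left_limits : ∀ᵐ ω ∂P, ∀ t, ∃ l : ℝ, Tendsto (fun s => γ s ω) (𝓝[<] t) (𝓝 l)
  laplace : ∀ (t : ℝ≥0) (l : ℝ), 0 ≤ l →
    ∫ ω, Real.exp (-l * γ t ω) ∂P = (1 + l) ^ (-(t : ℝ))

/-- The gamma bridge `ζ` of random length `τ`: `ζ t = γ (t ∧ τ) / γ τ`. -/
noncomputable def bridge {Ω : Type*} (γ : ℝ≥0 → Ω → ℝ) (τ : Ω → ℝ≥0) (t : ℝ≥0) (ω : Ω) : ℝ :=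
  γ (min t (τ ω)) ω / γ (τ ω) ω

/-- The drift `Z t = (1 - ζ t) / (τ - t)` on `{t < τ}`, and `Z t = 0` elsewhere. -/
noncomputable def drift {Ω : Type*} (γ : ℝ≥0 → Ω → ℝ) (τ : Ω → ℝ≥0) (t : ℝ≥0) (ω : Ω) : ℝ :=
  if t < τ ω then (1 - bridge γ τ t ω) / ((τ ω : ℝ) - (t : ℝ)) else 0

/-- The compensated process `N t = ζ t - ∫ s in 0..t, Z s`. -/
noncomputable def compensated {Ω : Type*} (γ : ℝ≥0 → Ω → ℝ) (τ : Ω → ℝ≥0) (t : ℝ≥0) (ω : Ω) : ℝ :=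
  bridge γ τ t ω - ∫ s in (0 : ℝ)..(t : ℝ), drift γ τ s.toNNReal ω

/-- A right-continuous process evaluated at a random time is measurable (on a complete space). -/
theorem measurable_at_random_time {Ω : Type*} [MeasurableSpace Ω] {P : Measure Ω} [P.IsComplete]
    {γ : ℝ≥0 → Ω → ℝ} (hγ : IsStandardGammaProcess γ P) {σ : Ω → ℝ≥0} (hσ : Measurable σ) :
    Measurable fun ω => γ (σ ω) ω := by
  obtain ⟨d, hd⟩ : ∃ d : ℕ → ℕ → ℝ≥0, ∀ n k, d n k = ((k : ℝ≥0) + 1) / ((n : ℝ≥0) + 1) :=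
    ⟨_, fun _ _ => rfl⟩
  obtain ⟨k, hkd⟩ : ∃ k : ℕ → Ω → ℕ, ∀ n, k n = fun ω => ⌊((n : ℝ≥0) + 1) * σ ω⌋₊ :=
    ⟨_, fun _ => rfl⟩
  have hk : ∀ n, Measurable (k n) := fun n => by
    rw [hkd n]; exact Nat.measurable_floor.comp (hσ.const_mul _)
  have hf : ∀ n, Measurable fun ω => γ (d n (k n ω)) ω := fun n => by
    have h1 : Measurable fun p : ℕ × Ω => γ (d n p.1) p.2 :=
      measurable_from_prod_countable_right fun j => hγ.measurable (d n j)
    exact h1.comp ((hk n).prodMk measurable_id)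
  have hlow : ∀ n ω, σ ω ≤ d n (k n ω) := fun n ω => by
    have h : ((n : ℝ≥0) + 1) * σ ω < (k n ω : ℝ≥0) + 1 := by
      rw [hkd n]; exact Nat.lt_floor_add_one _
    rw [hd, le_div_iff₀ (by positivity), mul_comm]
    exact h.le
  have hup : ∀ n ω, d n (k n ω) ≤ σ ω + 1 / ((n : ℝ≥0) + 1) := fun n ω => by
    have h : (k n ω : ℝ≥0) ≤ ((n : ℝ≥0) + 1) * σ ω := by
      rw [hkd n]; exact Nat.floor_le bot_le
    have h0 : (n : ℝ≥0) + 1 ≠ 0 := by positivity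
    rw [hd, div_le_iff₀ (by positivity), add_mul, one_div, inv_mul_cancel₀ h0, mul_comm (σ ω)]
    exact add_le_add h le_rfl
  have hlim : ∀ ω, Tendsto (fun n => d n (k n ω)) atTop (𝓝[≥] (σ ω)) := fun ω => by
    refine tendsto_nhdsWithin_iff.2 ⟨?_, Eventually.of_forall fun n => hlow n ω⟩
    have h1 : Tendsto (fun n : ℕ => 1 / ((n : ℝ≥0) + 1)) atTop (𝓝 0) := by
      rw [← NNReal.tendsto_coe]
      simpa using tendsto_one_div_add_atTop_nhds_zero_nat (𝕜 := ℝ)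
    have h2 : Tendsto (fun n : ℕ => σ ω + 1 / ((n : ℝ≥0) + 1)) atTop (𝓝 (σ ω)) := by
      have := h1.const_add (σ ω)
      rwa [add_zero] at this
    exact tendsto_of_tendsto_of_tendsto_of_le_of_le tendsto_const_nhds h2
      (fun n => hlow n ω) (fun n => hup n ω)
  have hae : AEMeasurable (fun ω => γ (σ ω) ω) P := by
    refine aemeasurable_of_tendsto_metrizable_ae atTop (fun n => (hf n).aemeasurable) ?_
    filter_upwards [hγ.right_continuous] with ω hω
    exact (hω (σ ω)).tendsto.comp (hlim ω)
  exact hae.nullMeasurable.measurable_of_complete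

theorem measurable_bridge {Ω : Type*} [MeasurableSpace Ω] {P : Measure Ω} [P.IsComplete]
    {γ : ℝ≥0 → Ω → ℝ} (hγ : IsStandardGammaProcess γ P) {τ : Ω → ℝ≥0} (hτ : Measurable τ)
    (t : ℝ≥0) : Measurable (bridge γ τ t) :=
  (measurable_at_random_time hγ (measurable_const.min hτ)).div (measurable_at_random_time hγ hτ)

/-- The completed natural filtration `σ(Y s, s ≤ t) ∨ 𝒩_P` of a real process `Y` on a complete
probability space, where `𝒩_P` is the collection of `P`-null sets. -/
noncomputable def completedNatural {Ω : Type*} [mΩ : MeasurableSpace Ω] (P : Measure Ω)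
    [P.IsComplete] (Y : ℝ≥0 → Ω → ℝ) (hY : ∀ t, Measurable (Y t)) : Filtration ℝ≥0 mΩ :=
  Filtration.natural Y (fun t => (hY t).stronglyMeasurable) ⊔
    Filtration.const ℝ≥0 (MeasurableSpace.generateFrom {A : Set Ω | P A = 0})
      (MeasurableSpace.generateFrom_le fun A hA => Measure.IsComplete.out' A hA)

/-- The initial enlargement `F t ∨ σ(τ)` of a filtration `F` by a random time `τ`. -/
noncomputable def initialEnlargement {Ω : Type*} [mΩ : MeasurableSpace Ω]
    (F : Filtration ℝ≥0 mΩ) (τ : Ω → ℝ≥0) (hτ : Measurable τ) : Filtration ℝ≥0 mΩ :=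
  F ⊔ Filtration.const ℝ≥0 (MeasurableSpace.comap τ inferInstance) hτ.comap_le

/-- The filtration `H t = F^{ζ,c} t ∨ σ(τ)` for the gamma bridge `ζ` of random length `τ`. -/
noncomputable def enlargedFiltration {Ω : Type*} [mΩ : MeasurableSpace Ω] {P : Measure Ω}
    [P.IsComplete] {γ : ℝ≥0 → Ω → ℝ} (hγ : IsStandardGammaProcess γ P)
    {τ : Ω → ℝ≥0} (hτ : Measurable τ) : Filtration ℝ≥0 mΩ :=
  initialEnlargement (completedNatural P (bridge γ τ) (measurable_bridge hγ hτ)) τ hτ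

end GammaBridge

/-! Since `τ` is independent of the path, the law of the pair is a product, and both claims reduce
to a deterministic length `r > 0`. There the key fact is exchangeability of increments. Given the
path up to `s` and the value `γ r`, the increments over two subintervals of `[s, r]` of equal length
have the same law (`identDistrib_past_increment_rest`).

Hence, on an event `A` of the bridge up to `s`, the integral of `ζ_{s+h} - ζ_s` is additive and
nonnegative in `h ∈ [0, r - s]`. It is therefore linear (`eq_div_mul_of_additive`), equal to `h / (r
- s)` times the integral of `1 - ζ_s` over `A`. The gamma law enters only through `γ r > 0` almost
surely.

Consequently the integral of `Z_u` over `A` does not depend on `u ∈ [s, r)`, and integrating it over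
`(s, t]` compensates the increment of `ζ` exactly (`setIntegral_compensated_sub_const`). For `s = 0`
this gives `E Z_u = 1 / r`, so the drift has total mass at most `1`.

Paths are right-continuous only almost surely, so Fubini is applied to jointly measurable versions.
Null sets belong to the enlarged filtration, so adaptedness survives the change of version. -/

namespace GammaBridge

/-! ### Jointly measurable versions of right-continuous processes -/

/-- The smallest point of the form `k / (n + 1)` strictly to the right of `v`. -/
noncomputable def gridAbove (n : ℕ) (v : ℝ≥0) : ℝ≥0 :=
  ((⌊((n : ℝ≥0) + 1) * v⌋₊ : ℝ≥0) + 1) / ((n : ℝ≥0) + 1)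

theorem tendsto_gridAbove (v : ℝ≥0) :
    Tendsto (fun n => gridAbove n v) atTop (𝓝[≥] v) := by
  have hlow : ∀ n, v ≤ gridAbove n v := fun n => by
    rw [gridAbove, le_div_iff₀ (by positivity), mul_comm]
    exact (Nat.lt_floor_add_one _).le
  have hup : ∀ n, gridAbove n v ≤ v + 1 / ((n : ℝ≥0) + 1) := fun n => by
    have h : (⌊((n : ℝ≥0) + 1) * v⌋₊ : ℝ≥0) ≤ ((n : ℝ≥0) + 1) * v := Nat.floor_le bot_le
    have h0 : (n : ℝ≥0) + 1 ≠ 0 := by positivity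
    rw [gridAbove, div_le_iff₀ (by positivity), add_mul v, one_div, inv_mul_cancel₀ h0, mul_comm v]
    exact add_le_add h le_rfl
  refine tendsto_nhdsWithin_iff.2 ⟨?_, Eventually.of_forall hlow⟩
  have h1 : Tendsto (fun n : ℕ => 1 / ((n : ℝ≥0) + 1)) atTop (𝓝 0) := by
    rw [← NNReal.tendsto_coe]
    simpa using tendsto_one_div_add_atTop_nhds_zero_nat (𝕜 := ℝ)
  have h2 : Tendsto (fun n : ℕ => v + 1 / ((n : ℝ≥0) + 1)) atTop (𝓝 v) := by
    have := h1.const_add v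
    rwa [add_zero] at this
  exact tendsto_of_tendsto_of_tendsto_of_le_of_le tendsto_const_nhds h2 hlow hup

/-- A jointly measurable version of a process with right-continuous paths. -/
noncomputable def rcVersion {α : Type*} (X : ℝ≥0 → α → ℝ) (v : ℝ≥0) (x : α) : ℝ :=
  limsup (fun n => X (gridAbove n v) x) atTop

/-- For fixed `n` the grid has countably many points, so measurability at each fixed time suffices.
-/
theorem measurable_comp_gridAbove {α : Type*} [MeasurableSpace α] {X : ℝ≥0 → α → ℝ}
    (hX : ∀ v, Measurable (X v)) (n : ℕ) :
    Measurable fun p : ℝ≥0 × α => X (gridAbove n p.1) p.2 := by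
  obtain ⟨g, hg⟩ : ∃ g : ℕ → ℝ≥0, ∀ k, g k = ((k : ℝ≥0) + 1) / ((n : ℝ≥0) + 1) :=
    ⟨_, fun _ => rfl⟩
  obtain ⟨k, hk, hkm⟩ : ∃ k : ℝ≥0 → ℕ, (∀ v, gridAbove n v = g (k v)) ∧ Measurable k :=
    ⟨fun v => ⌊((n : ℝ≥0) + 1) * v⌋₊, fun v => by rw [hg, gridAbove],
      Nat.measurable_floor.comp (measurable_id.const_mul _)⟩
  have h1 : Measurable fun p : ℕ × α => X (g p.1) p.2 :=
    measurable_from_prod_countable_right fun j => hX (g j)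
  simp only [hk]
  exact h1.comp ((hkm.comp measurable_fst).prodMk measurable_snd)

theorem measurable_rcVersion {α : Type*} [MeasurableSpace α] {X : ℝ≥0 → α → ℝ}
    (hX : ∀ v, Measurable (X v)) : Measurable fun p : ℝ≥0 × α => rcVersion X p.1 p.2 :=
  Measurable.limsup fun n => measurable_comp_gridAbove hX n

theorem rcVersion_eq {α : Type*} {X : ℝ≥0 → α → ℝ} {v : ℝ≥0} {x : α}
    (h : ContinuousWithinAt (fun u => X u x) (Set.Ici v) v) : rcVersion X v x = X v x :=
  (h.tendsto.comp (tendsto_gridAbove v)).limsup_eq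

/-! ### Pathwise dependence, joint measurability and stopping -/

section Congruence

variable {α β : Type*} {X : ℝ≥0 → α → ℝ} {Y : ℝ≥0 → β → ℝ} {σ : α → ℝ≥0} {ρ : β → ℝ≥0} {a : α} {b : β}

/-- This and the next two lemmas move between `Ω`, the space of lengths and paths, and a constant
length: only one path and one length matter. -/
theorem bridge_congr (h : ∀ v, X v a = Y v b) (hσ : σ a = ρ b) (t : ℝ≥0) :
    bridge X σ t a = bridge Y ρ t b := by
  simp only [bridge, h, hσ]

theorem drift_congr (h : ∀ v, X v a = Y v b) (hσ : σ a = ρ b) (t : ℝ≥0) :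
    drift X σ t a = drift Y ρ t b := by
  simp only [drift, bridge_congr h hσ, hσ]

theorem compensated_congr (h : ∀ v, X v a = Y v b) (hσ : σ a = ρ b) (t : ℝ≥0) :
    compensated X σ t a = compensated Y ρ t b := by
  simp only [compensated, bridge_congr h hσ, drift_congr h hσ]

end Congruence

section JointMeasurability

variable {α : Type*} [MeasurableSpace α] {X : ℝ≥0 → α → ℝ} {σ : α → ℝ≥0}

theorem measurable_uncurry_bridge (hX : Measurable fun p : ℝ≥0 × α => X p.1 p.2)
    (hσ : Measurable σ) : Measurable fun p : ℝ≥0 × α => bridge X σ p.1 p.2 :=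
  (hX.comp ((measurable_fst.min (hσ.comp measurable_snd)).prodMk measurable_snd)).div
    (hX.comp ((hσ.comp measurable_snd).prodMk measurable_snd))

theorem measurable_uncurry_drift (hX : Measurable fun p : ℝ≥0 × α => X p.1 p.2)
    (hσ : Measurable σ) : Measurable fun p : ℝ≥0 × α => drift X σ p.1 p.2 := by
  refine Measurable.ite (measurableSet_lt measurable_fst (hσ.comp measurable_snd)) ?_
    measurable_const
  exact ((measurable_uncurry_bridge hX hσ).const_sub 1).div
    (((hσ.comp measurable_snd).coe_nnreal_real).sub measurable_fst.coe_nnreal_real)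

theorem measurable_drift_toNNReal (hX : Measurable fun p : ℝ≥0 × α => X p.1 p.2)
    (hσ : Measurable σ) : Measurable fun p : α × ℝ => drift X σ p.2.toNNReal p.1 :=
  (measurable_uncurry_drift hX hσ).comp
    ((measurable_real_toNNReal.comp measurable_snd).prodMk measurable_fst)

theorem measurable_integral_drift (hX : Measurable fun p : ℝ≥0 × α => X p.1 p.2)
    (hσ : Measurable σ) (t : ℝ≥0) :
    Measurable fun a => ∫ s in (0 : ℝ)..(t : ℝ), drift X σ s.toNNReal a := by
  simp only [intervalIntegral.integral_of_le t.coe_nonneg]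
  exact (measurable_drift_toNNReal hX hσ).stronglyMeasurable.integral_prod_right'.measurable

theorem measurable_compensated (hX : Measurable fun p : ℝ≥0 × α => X p.1 p.2)
    (hσ : Measurable σ) (t : ℝ≥0) : Measurable (compensated X σ t) :=
  ((measurable_uncurry_bridge hX hσ).comp (measurable_const.prodMk measurable_id)).sub
    (measurable_integral_drift hX hσ t)

end JointMeasurability

/-- After `τ` the bridge is constant and the drift vanishes. -/
theorem compensated_min {Ω : Type*} (γ : ℝ≥0 → Ω → ℝ) (τ : Ω → ℝ≥0) (t : ℝ≥0) (ω : Ω) :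
    compensated γ τ (min t (τ ω)) ω = compensated γ τ t ω := by
  rw [compensated, compensated]
  congr 1
  · simp [bridge]
  · rw [intervalIntegral.integral_of_le (NNReal.coe_nonneg _),
      intervalIntegral.integral_of_le (NNReal.coe_nonneg _)]
    symm
    refine setIntegral_eq_of_subset_of_forall_sdiff_eq_zero measurableSet_Ioc
      (Set.Ioc_subset_Ioc_right (by simp)) fun s hs => ?_
    have : ¬ s.toNNReal < τ ω := by
      intro hlt
      refine hs.2 ⟨hs.1.1, ?_⟩
      rw [Real.toNNReal_lt_iff_lt_coe hs.1.1.le] at hlt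
      simp [hs.1.2, hlt.le]
    simp [drift, this]

theorem stoppedProcess_compensated {Ω : Type*} (γ : ℝ≥0 → Ω → ℝ) (τ : Ω → ℝ≥0) :
    stoppedProcess (compensated γ τ) (fun ω => (τ ω : WithTop ℝ≥0)) = compensated γ τ := by
  ext t ω
  rw [stoppedProcess, ← WithTop.coe_min, WithTop.untopA_eq_untop WithTop.coe_ne_top,
    WithTop.untop_coe, compensated_min]

/-! ### Reassociating independence; additive functions -/

theorem indepFun_prodMk_of_indepFun_prodMk {Ω α β δ : Type*} [MeasurableSpace Ω]
    [MeasurableSpace α] [MeasurableSpace β] [MeasurableSpace δ] {P : Measure Ω}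
    [IsProbabilityMeasure P] {f : Ω → α} {g : Ω → β} {h : Ω → δ}
    (hf : Measurable f) (hg : Measurable g) (hh : Measurable h) (hfg : IndepFun f g P)
    (hfgh : IndepFun (fun ω => (f ω, g ω)) h P) : IndepFun f (fun ω => (g ω, h ω)) P := by
  have hgh : IndepFun g h P := hfgh.comp measurable_snd measurable_id
  rw [indepFun_iff_map_prod_eq_prod_map_map hf.aemeasurable (hg.prodMk hh).aemeasurable]
  have := Measure.isProbabilityMeasure_map (μ := P) hf.aemeasurable
  have := Measure.isProbabilityMeasure_map (μ := P) hg.aemeasurable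
  have := Measure.isProbabilityMeasure_map (μ := P) hh.aemeasurable
  have e : P.map (fun ω => (f ω, (g ω, h ω))) =
      (P.map fun ω => ((f ω, g ω), h ω)).map MeasurableEquiv.prodAssoc := by
    rw [Measure.map_map MeasurableEquiv.prodAssoc.measurable ((hf.prodMk hg).prodMk hh)]
    rfl
  rw [e, hfgh.map_prod_eq_prod_map_map (hf.prodMk hg).aemeasurable hh.aemeasurable,
    hfg.map_prod_eq_prod_map_map hf.aemeasurable hg.aemeasurable,
    hgh.map_prod_eq_prod_map_map hg.aemeasurable hh.aemeasurable]
  exact (measurePreserving_prodAssoc _ _ _).map_eq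

/-- A nonnegative additive function on `[0, L]` is linear. -/
theorem eq_div_mul_of_additive {L : ℝ≥0} (hL : 0 < L) {φ : ℝ≥0 → ℝ}
    (hadd : ∀ p h, p + h ≤ L → φ (p + h) = φ p + φ h) (hnonneg : ∀ p ≤ L, 0 ≤ φ p)
    {h : ℝ≥0} (hh : h ≤ L) : φ h = (h : ℝ) / L * φ L := by
  have hmono : ∀ p q, p ≤ q → q ≤ L → φ p ≤ φ q := fun p q hpq hq => by
    have e : p + (q - p) = q := add_tsub_cancel_of_le hpq
    have := hadd p (q - p) (e.le.trans hq)
    rw [e] at this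
    linarith [hnonneg (q - p) (tsub_le_self.trans hq)]
  have hzero : φ 0 = 0 := by simpa using hadd 0 0 (by simp)
  have hL' : (0 : ℝ) < L := hL
  -- With mesh `d = L / (n + 1)`, additivity makes `φ` exact on multiples of `d`. For `k * d ≤ h ≤
  -- (k + 1) * d`, both `φ h` and `h / d * φ d` lie between `k * φ d` and `(k + 1) * φ d`, so they
  -- differ by at most `φ d = φ L / (n + 1)`.
  have key : ∀ n : ℕ, |φ h - (h : ℝ) / L * φ L| ≤ φ L * (1 / ((n : ℝ) + 1)) := by
    intro n
    obtain ⟨d, hd⟩ : ∃ d : ℝ≥0, d = L / ((n : ℝ≥0) + 1) := ⟨_, rfl⟩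
    have hdL : ((n : ℝ≥0) + 1) * d = L := by rw [hd]; field_simp
    have hd0 : 0 < d := by rw [hd]; positivity
    have hmul : ∀ k : ℕ, (k : ℝ≥0) * d ≤ L → φ (k * d) = k * φ d := by
      intro k
      induction k with
      | zero => simp [hzero]
      | succ k ih =>
        intro hk
        have e : ((k + 1 : ℕ) : ℝ≥0) * d = k * d + d := by push_cast; ring
        rw [e] at hk ⊢
        rw [hadd _ _ hk, ih (le_self_add.trans hk)]
        push_cast; ring
    have hφL : φ L = ((n : ℝ) + 1) * φ d := by
      have := hmul (n + 1) (by push_cast; exact hdL.le)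
      push_cast at this
      rwa [hdL] at this
    obtain ⟨k, hk⟩ : ∃ k : ℕ, k = ⌊h / d⌋₊ := ⟨_, rfl⟩
    have hk1 : (k : ℝ≥0) * d ≤ h := by
      rw [hk, ← le_div_iff₀ hd0]; exact Nat.floor_le bot_le
    have hk2 : h ≤ (k : ℝ≥0) * d + d := by
      have : h / d ≤ (k : ℝ≥0) + 1 := by rw [hk]; exact (Nat.lt_floor_add_one _).le
      rw [div_le_iff₀ hd0] at this
      rwa [add_mul, one_mul] at this
    have hdle : d ≤ L := by
      rw [← hdL]; exact le_mul_of_one_le_left bot_le (by simp)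
    have e : (k : ℝ≥0) * d + (h - k * d) = h := add_tsub_cancel_of_le hk1
    have hres : h - (k : ℝ≥0) * d ≤ d := tsub_le_iff_left.2 hk2
    have h1 := hadd (k * d) (h - k * d) (e.le.trans hh)
    rw [e, hmul k (hk1.trans hh)] at h1
    have h2 := hnonneg _ (hres.trans hdle)
    have h3 := hmono _ _ hres hdle
    have h4 := hnonneg d hdle
    have hk1' : (k : ℝ) * d ≤ h := by exact_mod_cast hk1
    have hk2' : (h : ℝ) ≤ (k : ℝ) * d + d := by exact_mod_cast hk2
    have hd0' : (0 : ℝ) < d := hd0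
    have hdL' : ((n : ℝ) + 1) * d = L := by exact_mod_cast hdL
    have e2 : (h : ℝ) / L * φ L = h / d * φ d := by
      rw [hφL, ← hdL']; field_simp
    have e3 : φ L * (1 / ((n : ℝ) + 1)) = φ d := by rw [hφL]; field_simp
    have h5 : (k : ℝ) ≤ h / d := by rwa [le_div_iff₀ hd0']
    have h6 : (h : ℝ) / d ≤ k + 1 := by rw [div_le_iff₀ hd0']; linarith
    rw [e2, e3, abs_le]
    constructor <;> nlinarith
  have hlim := (tendsto_one_div_add_atTop_nhds_zero_nat (𝕜 := ℝ)).const_mul (φ L)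
  rw [mul_zero] at hlim
  have := ge_of_tendsto' hlim key
  exact sub_eq_zero.1 (abs_nonpos_iff.1 this)

/-! ### Independence and exchangeability of the increments -/

section GammaPaths

variable {Ω : Type*} [MeasurableSpace Ω] {P : Measure Ω} {γ : ℝ≥0 → Ω → ℝ}

theorem measurable_past (hγ : IsStandardGammaProcess γ P) (s : ℝ≥0) :
    Measurable fun ω (u : Set.Iic s) => γ u ω :=
  measurable_pi_lambda _ fun u => hγ.measurable u

theorem measurable_increment (hγ : IsStandardGammaProcess γ P) (s t : ℝ≥0) :
    Measurable fun ω => γ t ω - γ s ω :=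
  (hγ.measurable t).sub (hγ.measurable s)

theorem identDistrib_increment (hγ : IsStandardGammaProcess γ P) (a b h : ℝ≥0) :
    IdentDistrib (fun ω => γ (a + h) ω - γ a ω) (fun ω => γ (b + h) ω - γ b ω) P P :=
  (hγ.stationary_increments a h).trans (hγ.stationary_increments b h).symm

variable [IsProbabilityMeasure P]

/-- Increments after time `s` are independent of the path up to time `s`. -/
theorem indepFun_past_increment (hγ : IsStandardGammaProcess γ P) {s b : ℝ≥0} (hsb : s ≤ b) :
    IndepFun (fun ω (u : Set.Iic s) => γ u ω) (fun ω => γ b ω - γ s ω) P := by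
  refine IndepFun.process_indepFun (fun u => hγ.measurable u) (measurable_increment hγ s b)
    fun I => ?_
  obtain ⟨k, hk⟩ : ∃ k, I.card = k := ⟨_, rfl⟩
  let em := I.orderEmbOfFin hk
  -- The times are `0`, the `k` points of `I` in increasing order, `s`, then `b` forever. Increment
  -- number `k + 1` is thus the one over `[s, b]`.
  let t : ℕ → ℝ≥0
    | 0 => 0
    | j + 1 => if h : j < k then (em ⟨j, h⟩ : Set.Iic s) else if j = k then s else b
  have hem : ∀ i, ((em i : Set.Iic s) : ℝ≥0) ≤ s := fun i => (em i).2
  have ht : Monotone t := by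
    refine monotone_nat_of_le_succ fun j => ?_
    rcases j with _ | j
    · simp [t]
    · simp only [t]
      split_ifs with h1 h2 h3 h4 h5 <;> first | omega | skip
      · exact Subtype.coe_le_coe.2 (em.monotone (Fin.mk_le_mk.2 j.le_succ))
      · exact hem _
      · exact le_rfl
  have hidx : ∀ i : I, ∃ m, m < k ∧ t (m + 1) = i := fun i => by
    have : (i : Set.Iic s) ∈ Set.range em := by
      rw [Finset.range_orderEmbOfFin]; exact i.2
    obtain ⟨m, hm⟩ := this
    exact ⟨m, m.2, by simp [t, hm]⟩
  choose m hmk hm using hidx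
  have hfin := (hγ.indep_increments.nat ht).indepFun_finset (Finset.range (k + 1)) {k + 1}
    (by simp) fun j => measurable_increment hγ _ _
  -- Partial sums of the earlier increments telescope to the values of `γ` on `I`, because `γ 0 = 0`
  -- almost surely.
  let F : (Finset.range (k + 1) → ℝ) → I → ℝ := fun x i =>
    ∑ j ∈ (Finset.range (m i + 1)).attach, x ⟨j, by
      have := Finset.mem_range.1 j.2
      have := hmk i
      exact Finset.mem_range.2 (by omega)⟩
  have hF : Measurable F := measurable_pi_lambda _ fun i =>
    Finset.measurable_sum _ fun j _ => measurable_pi_apply _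
  refine (hfin.comp hF (measurable_pi_apply ⟨k + 1, by simp⟩)).congr ?_ ?_
  · filter_upwards [hγ.start_zero] with ω hω
    funext i
    simp only [Function.comp, F]
    rw [Finset.sum_attach (Finset.range (m i + 1)) fun j => γ (t (j + 1)) ω - γ (t j) ω,
      Finset.sum_range_sub (fun j => γ (t j) ω), hm]
    simp [t, hω]
  · refine Eventually.of_forall fun ω => ?_
    simp [t]

/-- Exchanging an increment with the one just after `s` does not change the joint law of the past,
the increment and the sum of the remaining increments. -/
theorem identDistrib_past_increment_rest (hγ : IsStandardGammaProcess γ P) (s p h q : ℝ≥0) :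
    IdentDistrib
      (fun ω => (((fun u : Set.Iic s => γ u ω), γ (s + p + h) ω - γ (s + p) ω),
        (γ (s + p) ω - γ s ω) + (γ (s + p + h + q) ω - γ (s + p + h) ω)))
      (fun ω => (((fun u : Set.Iic s => γ u ω), γ (s + h) ω - γ s ω),
        γ (s + h + (p + q)) ω - γ (s + h) ω)) P P := by
  have hX := measurable_past hγ s
  have hI := fun a b => measurable_increment hγ a b
  have restr : ∀ (a b : ℝ≥0) (hab : a ≤ b), Measurable fun (x : Set.Iic b → ℝ) (u : Set.Iic a) =>
      x ⟨u, le_trans u.2 hab⟩ := fun a b hab =>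
    measurable_pi_lambda _ fun u => measurable_pi_apply _
  have hsub : ∀ (b : ℝ≥0) (x y : Set.Iic b), Measurable fun f : Set.Iic b → ℝ => f x - f y :=
    fun b x y => (measurable_pi_apply x).sub (measurable_pi_apply y)
  -- the past, followed by one increment, is independent of the next increment
  have two : ∀ (a b c : ℝ≥0) (hsa : s ≤ a) (hab : a ≤ b) (_ : b ≤ c), IndepFun
      (fun ω => ((fun u : Set.Iic s => γ u ω), γ b ω - γ a ω)) (fun ω => γ c ω - γ b ω) P :=
    fun a b c hsa hab hbc => (indepFun_past_increment hγ hbc).comp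
      (φ := fun x => ((fun u : Set.Iic s => x ⟨u, le_trans u.2 (hsa.trans hab)⟩),
        x ⟨b, Set.mem_Iic.2 le_rfl⟩ - x ⟨a, hab⟩))
      ((restr s b (hsa.trans hab)).prodMk (hsub _ _ _))
      measurable_id
  have one : ∀ (a b : ℝ≥0) (_ : s ≤ a) (_ : a ≤ b), IndepFun
      (fun ω (u : Set.Iic s) => γ u ω) (fun ω => γ b ω - γ a ω) P :=
    fun a b hsa hab => (two a a b hsa le_rfl hab).comp measurable_fst measurable_id
  have h1 : s ≤ s + p := le_self_add
  have h2 : s + p ≤ s + p + h := le_self_add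
  have h3 : s + p + h ≤ s + p + h + q := le_self_add
  have h4 : s ≤ s + h := le_self_add
  have h5 : s + h ≤ s + h + (p + q) := le_self_add
  have three : IndepFun (fun ω => (((fun u : Set.Iic s => γ u ω), γ (s + p + h) ω - γ (s + p) ω),
      γ (s + p) ω - γ s ω)) (fun ω => γ (s + p + h + q) ω - γ (s + p + h) ω) P :=
    (indepFun_past_increment hγ h3).comp
      (φ := fun x => (((fun u : Set.Iic s => x ⟨u, le_trans u.2 (h1.trans h2)⟩),
        x ⟨s + p + h, Set.mem_Iic.2 le_rfl⟩ - x ⟨s + p, h2⟩), x ⟨s + p, h2⟩ - x ⟨s, h1.trans h2⟩))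
      (((restr s (s + p + h) (h1.trans h2)).prodMk (hsub _ _ _)).prodMk
        (hsub _ _ _)) measurable_id
  -- Chronologically, the past with the `p`-increment is independent of the `h`-increment;
  -- reassociating isolates the `p`-increment instead.
  have hA1 : IndepFun (fun ω => ((fun u : Set.Iic s => γ u ω), γ (s + p + h) ω - γ (s + p) ω))
      (fun ω => γ (s + p) ω - γ s ω) P :=
    (indepFun_prodMk_of_indepFun_prodMk (hI _ _) hX (hI _ _) (one _ _ le_rfl h1).symm
      ((two s (s + p) (s + p + h) le_rfl h1 h2).comp measurable_swap measurable_id)).symm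
  have hrest := (indepFun_prodMk_of_indepFun_prodMk (hX.prodMk (hI _ _)) (hI _ _) (hI _ _) hA1
    three).comp measurable_id measurable_add
  -- The two intervals need not be adjacent, so the sum is compared with the independent adjacent
  -- increments `γ p` and `γ (p + q) - γ p`.
  have hsum : IdentDistrib
      (fun ω => (γ (s + p) ω - γ s ω) + (γ (s + p + h + q) ω - γ (s + p + h) ω))
      (γ (p + q)) P P := by
    have := ((hγ.stationary_increments s p).prodMk (identDistrib_increment hγ (s + p + h) p q)
      (three.comp measurable_snd measurable_id)
      (hγ.indep_increments.indepFun_eval_sub bot_le le_self_add hγ.start_zero)).comp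
      measurable_add
    convert this using 1
    · rfl
    funext ω
    exact (add_sub_cancel (γ p ω) (γ (p + q) ω)).symm
  exact IdentDistrib.prodMk
    (IdentDistrib.prodMk (IdentDistrib.refl hX.aemeasurable) (identDistrib_increment hγ _ _ _)
      (one _ _ h1 h2) (one _ _ le_rfl h4))
    (hsum.trans (hγ.stationary_increments (s + h) (p + q)).symm) hrest (two _ _ _ le_rfl h4 h5)

end GammaPaths

/-! ### Expected increments and drift of a bridge of deterministic length -/

theorem indicator_apply_congr {α β : Type*} {A : Set α} {B : Set β} {f : α → ℝ} {g : β → ℝ} {a : α}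
    {b : β} (h : a ∈ A ↔ b ∈ B) (e : f a = g b) : A.indicator f a = B.indicator g b := by
  by_cases ha : a ∈ A
  · rw [Set.indicator_of_mem ha, Set.indicator_of_mem (h.1 ha), e]
  · rw [Set.indicator_of_notMem ha, Set.indicator_of_notMem (fun hb => ha (h.2 hb))]

section GammaPaths

variable {Ω : Type*} [MeasurableSpace Ω] {P : Measure Ω} {γ : ℝ≥0 → Ω → ℝ}

theorem ae_increment_div_mem_Icc (hγ : IsStandardGammaProcess γ P) :
    ∀ᵐ ω ∂P, ∀ u v r : ℝ≥0, u ≤ v → v ≤ r →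
      (γ v ω - γ u ω) / γ r ω ∈ Set.Icc (0 : ℝ) 1 := by
  filter_upwards [hγ.start_zero, hγ.monotone_paths] with ω h0 hm u v r huv hvr
  have h1 : 0 ≤ γ u ω := h0.symm.le.trans (hm bot_le)
  have h2 : γ u ω ≤ γ v ω := hm huv
  have h3 : γ v ω ≤ γ r ω := hm hvr
  -- If `γ r ω = 0` the quotient is `0` by convention, so positivity is not needed here.
  exact ⟨div_nonneg (by linarith) (by linarith), div_le_one_of_le₀ (by linarith) (by linarith)⟩

theorem ae_bridge_mem_Icc (hγ : IsStandardGammaProcess γ P) (τ : Ω → ℝ≥0) :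
    ∀ᵐ ω ∂P, ∀ t : ℝ≥0, bridge γ τ t ω ∈ Set.Icc (0 : ℝ) 1 := by
  filter_upwards [ae_increment_div_mem_Icc hγ, hγ.start_zero] with ω h h0 t
  simpa [bridge, h0] using h 0 (min t (τ ω)) (τ ω) bot_le (min_le_right _ _)

theorem ae_drift_nonneg (hγ : IsStandardGammaProcess γ P) (τ : Ω → ℝ≥0) :
    ∀ᵐ ω ∂P, ∀ t : ℝ≥0, 0 ≤ drift γ τ t ω := by
  filter_upwards [ae_bridge_mem_Icc hγ τ] with ω h t
  rw [drift]
  split_ifs with hlt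
  · have : (t : ℝ) < τ ω := hlt
    exact div_nonneg (by linarith [(h t).2]) (by linarith)
  · exact le_rfl

theorem ae_rcVersion_eq (hγ : IsStandardGammaProcess γ P) :
    ∀ᵐ ω ∂P, ∀ v, rcVersion γ v ω = γ v ω := by
  filter_upwards [hγ.right_continuous] with ω h v
  exact rcVersion_eq (h v)

/-- The event that the path up to time `s` of the bridge of deterministic length `r` lies in
`S`. -/
def pastBridgeMem {Ω : Type*} (γ : ℝ≥0 → Ω → ℝ) (r s : ℝ≥0) (S : Set (Set.Iic s → ℝ)) : Set Ω :=
  {ω | (fun v : Set.Iic s => γ v ω / γ r ω) ∈ S}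

theorem measurableSet_pastBridgeMem (hγ : IsStandardGammaProcess γ P) (r : ℝ≥0) {s : ℝ≥0}
    {S : Set (Set.Iic s → ℝ)} (hS : MeasurableSet S) : MeasurableSet (pastBridgeMem γ r s S) :=
  (measurable_pi_lambda _ fun v : Set.Iic s =>
    (hγ.measurable v).div (hγ.measurable r) : Measurable _) hS

variable [IsProbabilityMeasure P]

/-- Chernoff bound: `P (γ r ≤ 0) ≤ E[exp (-n * γ r)] = (1 + n) ^ (-r)`, which tends to `0`. -/
theorem ae_pos (hγ : IsStandardGammaProcess γ P) {r : ℝ≥0} (hr : 0 < r) :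
    ∀ᵐ ω ∂P, 0 < γ r ω := by
  have hr' : (0 : ℝ) < r := hr
  have hm : MeasurableSet {ω | γ r ω ≤ 0} := measurableSet_le (hγ.measurable r) measurable_const
  have key : ∀ n : ℕ, P.real {ω | γ r ω ≤ 0} ≤ (1 + (n : ℝ)) ^ (-(r : ℝ)) := fun n => by
    have hl := hγ.laplace r n n.cast_nonneg
    have hpos : (0 : ℝ) < (1 + (n : ℝ)) ^ (-(r : ℝ)) := by positivity
    have hint : Integrable (fun ω => Real.exp (-(n : ℝ) * γ r ω)) P := by
      -- A non-integrable function has integral `0`, whereas the Laplace transform is positive.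
      by_contra hni
      rw [integral_undef hni] at hl
      exact hpos.ne hl
    rw [← hl, ← integral_indicator_one hm]
    refine integral_mono ((integrable_const (1 : ℝ)).indicator hm) hint fun ω => ?_
    by_cases hω : γ r ω ≤ 0
    · rw [Set.indicator_of_mem (show ω ∈ {ω | γ r ω ≤ 0} from hω)]
      exact Real.one_le_exp (by nlinarith [n.cast_nonneg (α := ℝ)])
    · rw [Set.indicator_of_notMem (show ω ∉ {ω | γ r ω ≤ 0} from hω)]
      exact (Real.exp_pos _).le
  have hlim : Tendsto (fun n : ℕ => (1 + (n : ℝ)) ^ (-(r : ℝ))) atTop (𝓝 0) :=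
    (tendsto_rpow_neg_atTop hr').comp
      (tendsto_atTop_add_const_left _ 1 tendsto_natCast_atTop_atTop)
  have h0 : P.real {ω | γ r ω ≤ 0} = 0 :=
    le_antisymm (ge_of_tendsto' hlim key) measureReal_nonneg
  rw [measureReal_eq_zero_iff] at h0
  rw [ae_iff]
  simpa only [not_lt] using h0

theorem integrable_increment_div (hγ : IsStandardGammaProcess γ P) {u v r : ℝ≥0} (huv : u ≤ v)
    (hvr : v ≤ r) : Integrable (fun ω => (γ v ω - γ u ω) / γ r ω) P := by
  refine Integrable.of_bound
    ((measurable_increment hγ u v).div (hγ.measurable r)).aestronglyMeasurable 1 ?_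
  filter_upwards [ae_increment_div_mem_Icc hγ] with ω h
  rw [Real.norm_eq_abs, abs_of_nonneg (h u v r huv hvr).1]
  exact (h u v r huv hvr).2

/-- The final value is `γ s` plus the chosen increment plus the rest (`D` below). Event and
integrand are therefore the same function of the two triples matched by
`identDistrib_past_increment_rest`. -/
theorem setIntegral_increment_div_shift (hγ : IsStandardGammaProcess γ P) (s p h q : ℝ≥0)
    {S : Set (Set.Iic s → ℝ)} (hS : MeasurableSet S) :
    ∫ ω in pastBridgeMem γ (s + p + h + q) s S,
        (γ (s + p + h) ω - γ (s + p) ω) / γ (s + p + h + q) ω ∂P =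
      ∫ ω in pastBridgeMem γ (s + p + h + q) s S,
        (γ (s + h) ω - γ s ω) / γ (s + p + h + q) ω ∂P := by
  let e : Set.Iic s := ⟨s, Set.mem_Iic.2 le_rfl⟩
  let D : ((Set.Iic s → ℝ) × ℝ) × ℝ → ℝ := fun y => y.1.1 e + y.1.2 + y.2
  have hc : ∀ v : Set.Iic s, Measurable fun y : ((Set.Iic s → ℝ) × ℝ) × ℝ => y.1.1 v := fun v =>
    (measurable_pi_apply v).comp (measurable_fst.comp measurable_fst)
  have hD : Measurable D := ((hc e).add (measurable_snd.comp measurable_fst)).add measurable_snd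
  let T : Set (((Set.Iic s → ℝ) × ℝ) × ℝ) := {y | (fun v => y.1.1 v / D y) ∈ S}
  have hT : MeasurableSet T :=
    (measurable_pi_lambda _ fun v => (hc v).div hD : Measurable _) hS
  have hF : Measurable (T.indicator fun y => y.1.2 / D y) :=
    ((measurable_snd.comp measurable_fst).div hD).indicator hT
  have key := ((identDistrib_past_increment_rest hγ s p h q).comp hF).integral_eq
  rw [← integral_indicator (measurableSet_pastBridgeMem hγ _ hS),
    ← integral_indicator (measurableSet_pastBridgeMem hγ _ hS)]
  convert key using 1
  · refine integral_congr_ae (Eventually.of_forall fun ω => ?_)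
    have hDω : D (((fun u : Set.Iic s => γ u ω), γ (s + p + h) ω - γ (s + p) ω),
        (γ (s + p) ω - γ s ω) + (γ (s + p + h + q) ω - γ (s + p + h) ω)) =
        γ (s + p + h + q) ω := by
      simp only [D, e]; ring
    refine indicator_apply_congr ?_ ?_
    · simp only [T, pastBridgeMem, Set.mem_ofPred_eq, hDω]
    · simp only [hDω]
  · refine integral_congr_ae (Eventually.of_forall fun ω => ?_)
    have hr : s + h + (p + q) = s + p + h + q := by ring
    have hDω : D (((fun u : Set.Iic s => γ u ω), γ (s + h) ω - γ s ω),
        γ (s + h + (p + q)) ω - γ (s + h) ω) = γ (s + p + h + q) ω := by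
      simp only [D, e, hr]; ring
    refine indicator_apply_congr ?_ ?_
    · simp only [T, pastBridgeMem, Set.mem_ofPred_eq, hDω]
    · simp only [hDω]

/-- Given the past of the bridge of length `r` up to time `s`, the expected increment of the bridge
over `[s, s + h]` is proportional to `h`. -/
theorem setIntegral_increment_div (hγ : IsStandardGammaProcess γ P) {s r h : ℝ≥0} (hsr : s < r)
    (hh : s + h ≤ r) {S : Set (Set.Iic s → ℝ)} (hS : MeasurableSet S) :
    ∫ ω in pastBridgeMem γ r s S, (γ (s + h) ω - γ s ω) / γ r ω ∂P =
      (h : ℝ) / ((r : ℝ) - s) * ∫ ω in pastBridgeMem γ r s S, (γ r ω - γ s ω) / γ r ω ∂P := by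
  obtain ⟨L, rfl⟩ : ∃ L, r = s + L := ⟨r - s, (add_tsub_cancel_of_le hsr.le).symm⟩
  have hL : 0 < L := by simpa using hsr
  have := eq_div_mul_of_additive (h := h) hL
    (φ := fun h => ∫ ω in pastBridgeMem γ (s + L) s S, (γ (s + h) ω - γ s ω) / γ (s + L) ω ∂P)
    ?_ ?_ (by simpa using hh)
  · simpa using this
  · intro p h hph
    obtain ⟨q, rfl⟩ : ∃ q, L = p + h + q := ⟨L - (p + h), (add_tsub_cancel_of_le hph).symm⟩
    have e : s + (p + h + q) = s + p + h + q := by ring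
    have e' : s + (p + h) = s + p + h := by ring
    simp only [e, e']
    rw [← setIntegral_increment_div_shift hγ s p h q hS, ← integral_add]
    · refine integral_congr_ae (Eventually.of_forall fun ω => ?_)
      simp only
      ring
    · exact (integrable_increment_div hγ le_self_add
        (le_self_add.trans le_self_add)).integrableOn
    · exact (integrable_increment_div hγ le_self_add le_self_add).integrableOn
  · intro p hp
    refine integral_nonneg_of_ae (ae_restrict_of_ae ?_)
    filter_upwards [ae_increment_div_mem_Icc hγ] with ω h
    exact (h s (s + p) (s + L) le_self_add (by gcongr)).1

theorem pastBridgeMem_eq {Ω : Type*} (γ : ℝ≥0 → Ω → ℝ) {r s : ℝ≥0} (hsr : s ≤ r)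
    (S : Set (Set.Iic s → ℝ)) :
    pastBridgeMem γ r s S = {ω | (fun v : Set.Iic s => bridge γ (fun _ => r) v ω) ∈ S} := by
  have : ∀ v : Set.Iic s, min (v : ℝ≥0) r = v := fun v => min_eq_left (le_trans v.2 hsr)
  simp only [pastBridgeMem, bridge, this]

theorem setIntegral_bridge_sub (hγ : IsStandardGammaProcess γ P) {s u r : ℝ≥0} (hsr : s < r)
    (hsu : s ≤ u) (hur : u ≤ r) {S : Set (Set.Iic s → ℝ)} (hS : MeasurableSet S) :
    ∫ ω in {ω | (fun v : Set.Iic s => bridge γ (fun _ => r) v ω) ∈ S},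
        (bridge γ (fun _ => r) u ω - bridge γ (fun _ => r) s ω) ∂P =
      ((u : ℝ) - s) / ((r : ℝ) - s) *
        ∫ ω in {ω | (fun v : Set.Iic s => bridge γ (fun _ => r) v ω) ∈ S},
          (1 - bridge γ (fun _ => r) s ω) ∂P := by
  obtain ⟨h, rfl⟩ : ∃ h, u = s + h := ⟨u - s, (add_tsub_cancel_of_le hsu).symm⟩
  rw [← pastBridgeMem_eq γ hsr.le]
  have key := setIntegral_increment_div hγ hsr hur hS
  have e1 : ∀ ω, bridge γ (fun _ => r) (s + h) ω - bridge γ (fun _ => r) s ω =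
      (γ (s + h) ω - γ s ω) / γ r ω := fun ω => by
    simp only [bridge, min_eq_left hur, min_eq_left hsr.le]; ring
  -- Writing `1` as `γ r / γ r` is where almost sure positivity is needed.
  have e2 : ∀ᵐ ω ∂P, 1 - bridge γ (fun _ => r) s ω = (γ r ω - γ s ω) / γ r ω := by
    filter_upwards [ae_pos hγ (bot_le.trans_lt hsr)] with ω hω
    simp only [bridge, min_eq_left hsr.le]
    field_simp
  simp only [e1]
  rw [key, integral_congr_ae (ae_restrict_of_ae e2)]
  simp

theorem integrable_bridge (hγ : IsStandardGammaProcess γ P) [P.IsComplete] {τ : Ω → ℝ≥0}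
    (hτ : Measurable τ) (t : ℝ≥0) : Integrable (bridge γ τ t) P := by
  refine Integrable.of_bound (measurable_bridge hγ hτ t).aestronglyMeasurable 1 ?_
  filter_upwards [ae_bridge_mem_Icc hγ τ] with ω h
  rw [Real.norm_eq_abs, abs_of_nonneg (h t).1]
  exact (h t).2

/-- Subtracting the linear growth of `ζ` leaves the fraction `(r - u) / (r - s)` of the mass of `1 -
ζ_s`; division by `r - u` removes `u`. -/
theorem setIntegral_drift (hγ : IsStandardGammaProcess γ P) [P.IsComplete] {s u r : ℝ≥0}
    (hsu : s ≤ u) (hur : u < r) {S : Set (Set.Iic s → ℝ)} (hS : MeasurableSet S) :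
    ∫ ω in {ω | (fun v : Set.Iic s => bridge γ (fun _ => r) v ω) ∈ S},
        drift γ (fun _ => r) u ω ∂P =
      (∫ ω in {ω | (fun v : Set.Iic s => bridge γ (fun _ => r) v ω) ∈ S},
          (1 - bridge γ (fun _ => r) s ω) ∂P) / ((r : ℝ) - s) := by
  have hb := fun t => (integrable_bridge hγ (measurable_const (a := r)) t).integrableOn
    (s := {ω | (fun v : Set.Iic s => bridge γ (fun _ => r) v ω) ∈ S})
  have hur' : (u : ℝ) < r := hur
  have hsu' : (s : ℝ) ≤ u := hsu
  have key := setIntegral_bridge_sub hγ (hsu.trans_lt hur) hsu hur.le hS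
  have e : ∀ ω, drift γ (fun _ => r) u ω = ((1 - bridge γ (fun _ => r) s ω) -
      (bridge γ (fun _ => r) u ω - bridge γ (fun _ => r) s ω)) / ((r : ℝ) - u) := fun ω => by
    rw [drift, if_pos hur]; ring
  simp only [e]
  have hf : IntegrableOn (fun ω => 1 - bridge γ (fun _ => r) s ω)
      {ω | (fun v : Set.Iic s => bridge γ (fun _ => r) v ω) ∈ S} P :=
    (integrable_const _).sub (hb s)
  have hg : IntegrableOn (fun ω => bridge γ (fun _ => r) u ω - bridge γ (fun _ => r) s ω)
      {ω | (fun v : Set.Iic s => bridge γ (fun _ => r) v ω) ∈ S} P := (hb u).sub (hb s)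
  rw [integral_div, integral_sub hf hg, key]
  have h1 : (r : ℝ) - u ≠ 0 := by linarith
  have h2 : (r : ℝ) - s ≠ 0 := by linarith
  field_simp
  ring

theorem integral_drift_const (hγ : IsStandardGammaProcess γ P) [P.IsComplete] {u r : ℝ≥0}
    (hur : u < r) : ∫ ω, drift γ (fun _ => r) u ω ∂P = 1 / (r : ℝ) := by
  have key := setIntegral_drift hγ bot_le hur (MeasurableSet.univ (α := Set.Iic (⊥ : ℝ≥0) → ℝ))
  have e : ∀ᵐ ω ∂P, 1 - bridge γ (fun _ => r) (⊥ : ℝ≥0) ω = 1 := by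
    filter_upwards [hγ.start_zero] with ω hω
    simp [bridge, hω]
  simp only [Set.mem_univ, Set.ofPred_true, Measure.restrict_univ] at key
  rw [key, integral_congr_ae e]
  simp

end GammaPaths

/-! ### Averaging over the length; integrability of the drift -/

section Paths

variable {Ω : Type*} [MeasurableSpace Ω] {P : Measure Ω} {γ : ℝ≥0 → Ω → ℝ} {τ : Ω → ℝ≥0}

/-- Evaluation of a right-continuous path, as a process on pairs of a time and a path. -/
noncomputable def pathEval : ℝ≥0 → ℝ≥0 × (ℝ≥0 → ℝ) → ℝ :=
  rcVersion fun u p => p.2 u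

/-- The length coordinate is ignored by `pathEval`; it is carried so that `Prod.fst` can play the
role of `τ`. -/
theorem measurable_pathEval :
    Measurable fun q : ℝ≥0 × (ℝ≥0 × (ℝ≥0 → ℝ)) => pathEval q.1 q.2 :=
  measurable_rcVersion fun v => (measurable_pi_apply v).comp measurable_snd

theorem ae_pathEval_eq (hγ : IsStandardGammaProcess γ P) :
    ∀ᵐ ω ∂P, ∀ r v, pathEval v (r, fun t => γ t ω) = γ v ω := by
  filter_upwards [ae_rcVersion_eq hγ] with ω h r v
  exact h v

theorem measurable_path (hγ : IsStandardGammaProcess γ P) : Measurable fun ω t => γ t ω :=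
  measurable_pi_lambda _ hγ.measurable

theorem aestronglyMeasurable_drift [SFinite P] (hγ : IsStandardGammaProcess γ P)
    (hτ : Measurable τ) (ν : Measure ℝ) [SFinite ν] :
    AEStronglyMeasurable (fun p : Ω × ℝ => drift γ τ p.2.toNNReal p.1) (P.prod ν) := by
  refine (measurable_drift_toNNReal (measurable_rcVersion hγ.measurable)
    hτ).aestronglyMeasurable.congr ?_
  filter_upwards [Measure.quasiMeasurePreserving_fst.ae (ae_rcVersion_eq hγ)] with p hp
  exact drift_congr hp rfl _

variable [IsProbabilityMeasure P]

theorem map_time_path (hγ : IsStandardGammaProcess γ P) (hτ : Measurable τ)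
    (hindep : IndepFun τ (fun ω t => γ t ω) P) :
    P.map (fun ω => (τ ω, fun t => γ t ω)) = (P.map τ).prod (P.map fun ω t => γ t ω) :=
  hindep.map_prod_eq_prod_map_map hτ.aemeasurable (measurable_path hγ).aemeasurable

theorem lintegral_time_path (hγ : IsStandardGammaProcess γ P) (hτ : Measurable τ)
    (hindep : IndepFun τ (fun ω t => γ t ω) P) {Φ : ℝ≥0 × (ℝ≥0 → ℝ) → ℝ≥0∞} (hΦ : Measurable Φ) :
    ∫⁻ ω, Φ (τ ω, fun t => γ t ω) ∂P =
      ∫⁻ r, ∫⁻ ω, Φ (r, fun t => γ t ω) ∂P ∂(P.map τ) := by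
  have hW := measurable_path hγ
  have := Measure.isProbabilityMeasure_map (μ := P) hW.aemeasurable
  rw [← lintegral_map hΦ (hτ.prodMk hW), map_time_path hγ hτ hindep,
    lintegral_prod _ hΦ.aemeasurable]
  refine lintegral_congr fun r => ?_
  rw [lintegral_map (f := fun w => Φ (r, w)) (hΦ.comp measurable_prodMk_left) hW]

theorem integral_time_path_eq_zero (hγ : IsStandardGammaProcess γ P) (hτ : Measurable τ)
    (hτ_pos : ∀ ω, 0 < τ ω) (hindep : IndepFun τ (fun ω t => γ t ω) P)
    {Φ : ℝ≥0 × (ℝ≥0 → ℝ) → ℝ} (hΦ : Measurable Φ)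
    (hint : Integrable (fun ω => Φ (τ ω, fun t => γ t ω)) P)
    (h0 : ∀ r, 0 < r → ∫ ω, Φ (r, fun t => γ t ω) ∂P = 0) :
    ∫ ω, Φ (τ ω, fun t => γ t ω) ∂P = 0 := by
  have hW := measurable_path hγ
  have := Measure.isProbabilityMeasure_map (μ := P) hW.aemeasurable
  have := Measure.isProbabilityMeasure_map (μ := P) hτ.aemeasurable
  have hint' : Integrable Φ (P.map fun ω => (τ ω, fun t => γ t ω)) :=
    (integrable_map_measure hΦ.aestronglyMeasurable (hτ.prodMk hW).aemeasurable).2 hint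
  rw [← integral_map (hτ.prodMk hW).aemeasurable hΦ.aestronglyMeasurable]
  rw [map_time_path hγ hτ hindep] at hint' ⊢
  rw [integral_prod _ hint']
  refine integral_eq_zero_of_ae ?_
  have hpos : ∀ᵐ r ∂(P.map τ), 0 < r :=
    (ae_map_iff hτ.aemeasurable measurableSet_Ioi).2 (Eventually.of_forall hτ_pos)
  filter_upwards [hpos] with r hr
  rw [integral_map (f := fun w => Φ (r, w)) hW.aemeasurable
    (hΦ.comp measurable_prodMk_left).aestronglyMeasurable]
  exact h0 r hr

variable [P.IsComplete]

theorem lintegral_drift_const (hγ : IsStandardGammaProcess γ P) {u r : ℝ≥0} (hur : u < r) :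
    ∫⁻ ω, ENNReal.ofReal |drift γ (fun _ => r) u ω| ∂P = ENNReal.ofReal (1 / (r : ℝ)) := by
  have hint : Integrable (drift γ (fun _ => r) u) P := by
    have : drift γ (fun _ => r) u = fun ω => (1 - bridge γ (fun _ => r) u ω) / ((r : ℝ) - u) := by
      funext ω
      rw [drift, if_pos hur]
    rw [this]
    exact ((integrable_const _).sub (integrable_bridge hγ measurable_const u)).div_const _
  rw [← integral_drift_const hγ hur, ofReal_integral_eq_lintegral_ofReal hint]
  · refine lintegral_congr_ae ?_
    filter_upwards [ae_drift_nonneg hγ fun _ => r] with ω h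
    rw [abs_of_nonneg (h u)]
  · filter_upwards [ae_drift_nonneg hγ fun _ => r] with ω h
    exact h u

/-- By Tonelli, the constant mean `1 / r` is integrated over a subset of `(0, r)`. -/
theorem lintegral_lintegral_drift_const_le_one (hγ : IsStandardGammaProcess γ P) {r : ℝ≥0}
    (hr : 0 < r) (t : ℝ≥0) :
    ∫⁻ ω, (∫⁻ s in Set.Ioc 0 (t : ℝ),
      ENNReal.ofReal |drift γ (fun _ => r) s.toNNReal ω|) ∂P ≤ 1 := by
  have hr' : (0 : ℝ) < r := hr
  rw [lintegral_lintegral_swap]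
  · calc ∫⁻ s in Set.Ioc 0 (t : ℝ), ∫⁻ ω, ENNReal.ofReal |drift γ (fun _ => r) s.toNNReal ω| ∂P
        ≤ ∫⁻ s in Set.Ioc 0 (t : ℝ),
            (Set.Iio (r : ℝ)).indicator (fun _ => ENNReal.ofReal (1 / (r : ℝ))) s := by
          refine setLIntegral_mono ((measurable_const.indicator measurableSet_Iio)) fun s hs => ?_
          by_cases hsr : s < r
          · rw [Set.indicator_of_mem (Set.mem_Iio.2 hsr), lintegral_drift_const hγ]
            rwa [Real.toNNReal_lt_iff_lt_coe hs.1.le]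
          · have : ¬ s.toNNReal < r := by rwa [Real.toNNReal_lt_iff_lt_coe hs.1.le]
            simp [drift, this]
      _ = ∫⁻ s in Set.Iio (r : ℝ) ∩ Set.Ioc 0 (t : ℝ), ENNReal.ofReal (1 / (r : ℝ)) := by
          rw [lintegral_indicator measurableSet_Iio, Measure.restrict_restrict measurableSet_Iio]
      _ ≤ ∫⁻ s in Set.Ioo 0 (r : ℝ), ENNReal.ofReal (1 / (r : ℝ)) :=
          lintegral_mono_set fun s hs => ⟨hs.2.1, hs.1⟩
      _ = 1 := by
          rw [setLIntegral_const, Real.volume_Ioo, ← ENNReal.ofReal_mul (by positivity)]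
          simp [hr'.ne']
  · exact (measurable_norm.comp_aemeasurable
      (aestronglyMeasurable_drift hγ measurable_const _).aemeasurable).ennreal_ofReal

theorem lintegral_lintegral_drift_le_one (hγ : IsStandardGammaProcess γ P) (hτ : Measurable τ)
    (hτ_pos : ∀ ω, 0 < τ ω) (hindep : IndepFun τ (fun ω t => γ t ω) P) (t : ℝ≥0) :
    ∫⁻ ω, (∫⁻ s in Set.Ioc 0 (t : ℝ), ENNReal.ofReal |drift γ τ s.toNNReal ω|) ∂P ≤ 1 := by
  have hΦ : Measurable fun p => ∫⁻ s in Set.Ioc 0 (t : ℝ),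
      ENNReal.ofReal |drift pathEval Prod.fst s.toNNReal p| :=
    (measurable_norm.comp (measurable_drift_toNNReal measurable_pathEval
      measurable_fst)).ennreal_ofReal.lintegral_prod_right'
  have e : ∀ᵐ ω ∂P, ∫⁻ s in Set.Ioc 0 (t : ℝ), ENNReal.ofReal |drift γ τ s.toNNReal ω| =
      ∫⁻ s in Set.Ioc 0 (t : ℝ),
        ENNReal.ofReal |drift pathEval Prod.fst s.toNNReal (τ ω, fun t => γ t ω)| := by
    filter_upwards [ae_pathEval_eq hγ] with ω h
    refine lintegral_congr fun s => ?_
    rw [drift_congr (σ := τ) (ρ := Prod.fst) (fun v => (h (τ ω) v).symm) rfl]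
  rw [lintegral_congr_ae e, lintegral_time_path hγ hτ hindep hΦ]
  have := Measure.isProbabilityMeasure_map (μ := P) hτ.aemeasurable
  have hpos : ∀ᵐ r ∂(P.map τ), 0 < r :=
    (ae_map_iff hτ.aemeasurable measurableSet_Ioi).2 (Eventually.of_forall hτ_pos)
  calc _ ≤ ∫⁻ _, 1 ∂(P.map τ) := by
        refine lintegral_mono_ae ?_
        filter_upwards [hpos] with r hr
        refine le_of_eq_of_le (lintegral_congr_ae ?_)
          (lintegral_lintegral_drift_const_le_one hγ hr t)
        filter_upwards [ae_pathEval_eq hγ] with ω h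
        refine lintegral_congr fun s => ?_
        rw [drift_congr (σ := Prod.fst) (ρ := fun _ : Ω => r) (h r) rfl]
    _ = 1 := by simp

theorem integrable_drift (hγ : IsStandardGammaProcess γ P) (hτ : Measurable τ)
    (hτ_pos : ∀ ω, 0 < τ ω) (hindep : IndepFun τ (fun ω t => γ t ω) P) (t : ℝ≥0) :
    Integrable (fun p : Ω × ℝ => drift γ τ p.2.toNNReal p.1)
      (P.prod (volume.restrict (Set.Ioc 0 (t : ℝ)))) := by
  have hm := aestronglyMeasurable_drift hγ hτ (volume.restrict (Set.Ioc 0 (t : ℝ)))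
  refine ⟨hm, ?_⟩
  rw [hasFiniteIntegral_iff_norm, lintegral_prod _ hm.norm.aemeasurable.ennreal_ofReal]
  exact (lintegral_lintegral_drift_le_one hγ hτ hτ_pos hindep t).trans_lt ENNReal.one_lt_top

theorem ae_intervalIntegrable_drift (hγ : IsStandardGammaProcess γ P) (hτ : Measurable τ)
    (hτ_pos : ∀ ω, 0 < τ ω) (hindep : IndepFun τ (fun ω t => γ t ω) P) :
    ∀ᵐ ω ∂P, ∀ t : ℝ≥0,
      IntervalIntegrable (fun s : ℝ => drift γ τ s.toNNReal ω) volume 0 t := by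
  -- Integer horizons give one null set valid for all `t`.
  have h : ∀ᵐ ω ∂P, ∀ n : ℕ, Integrable (fun s : ℝ => drift γ τ s.toNNReal ω)
      (volume.restrict (Set.Ioc 0 (n : ℝ))) :=
    ae_all_iff.2 fun n => by
      simpa using (integrable_drift hγ hτ hτ_pos hindep n).prod_right_ae
  filter_upwards [h] with ω h t
  obtain ⟨n, hn⟩ := exists_nat_ge (t : ℝ)
  rw [intervalIntegrable_iff_integrableOn_Ioc_of_le t.coe_nonneg]
  exact IntegrableOn.mono_set (h n) (Set.Ioc_subset_Ioc_right hn)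

theorem integrable_compensated (hγ : IsStandardGammaProcess γ P) (hτ : Measurable τ)
    (hτ_pos : ∀ ω, 0 < τ ω) (hindep : IndepFun τ (fun ω t => γ t ω) P) (t : ℝ≥0) :
    Integrable (compensated γ τ t) P := by
  have := (integrable_drift hγ hτ hτ_pos hindep t).integral_prod_left
  refine (integrable_bridge hγ hτ t).sub ?_
  simpa only [intervalIntegral.integral_of_le t.coe_nonneg] using this

end Paths

/-! ### The martingale identity for a deterministic length -/

theorem setIntegral_compensated_sub_const {Ω : Type*} [MeasurableSpace Ω] {P : Measure Ω}
    [IsProbabilityMeasure P] [P.IsComplete] {γ : ℝ≥0 → Ω → ℝ} (hγ : IsStandardGammaProcess γ P)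
    {s t r : ℝ≥0} (hr : 0 < r) (hst : s ≤ t) {S : Set (Set.Iic s → ℝ)} (hS : MeasurableSet S) :
    ∫ ω in {ω | (fun v : Set.Iic s => bridge γ (fun _ => r) v ω) ∈ S},
      (compensated γ (fun _ => r) t ω - compensated γ (fun _ => r) s ω) ∂P = 0 := by
  have hmin : ∀ u ω, compensated γ (fun _ => r) (min u r) ω = compensated γ (fun _ => r) u ω :=
    compensated_min γ fun _ => r
  rcases le_or_gt r s with hrs | hsr
  · have : ∀ ω, compensated γ (fun _ => r) t ω - compensated γ (fun _ => r) s ω = 0 := fun ω => by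
      rw [← hmin t, ← hmin s, min_eq_right hrs, min_eq_right (hrs.trans hst), sub_self]
    simp [this]
  -- The process is constant after `r`, so `t` may be replaced by `min t r`.
  wlog htr : t ≤ r generalizing t
  · have := this (le_min hst hsr.le) (min_le_right t r)
    simpa only [hmin] using this
  have hsr' : (s : ℝ) < r := hsr
  have hst' : (s : ℝ) ≤ t := hst
  have hindep : IndepFun (fun _ : Ω => r) (fun ω t => γ t ω) P := indepFun_const_left r _
  have hm : Measurable fun _ : Ω => r := measurable_const
  obtain ⟨A, hA⟩ : ∃ A, A = {ω | (fun v : Set.Iic s => bridge γ (fun _ => r) v ω) ∈ S} := ⟨_, rfl⟩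
  obtain ⟨c, hc⟩ : ∃ c, c = ∫ ω in A, (1 - bridge γ (fun _ => r) s ω) ∂P := ⟨_, rfl⟩
  have hI := integrable_drift hγ hm (fun _ => hr) hindep t
  have hI' : Integrable (fun p : Ω × ℝ => drift γ (fun _ => r) p.2.toNNReal p.1)
      ((P.restrict A).prod (volume.restrict (Set.Ioc (s : ℝ) t))) :=
    hI.mono_measure (Measure.prod_mono Measure.restrict_le_self
      (Measure.restrict_mono (Set.Ioc_subset_Ioc_left s.coe_nonneg) le_rfl))
  have e : ∀ᵐ ω ∂(P.restrict A),
      compensated γ (fun _ => r) t ω - compensated γ (fun _ => r) s ω =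
        (bridge γ (fun _ => r) t ω - bridge γ (fun _ => r) s ω) -
          ∫ u in Set.Ioc (s : ℝ) t, drift γ (fun _ => r) u.toNNReal ω := by
    refine ae_restrict_of_ae ?_
    filter_upwards [ae_intervalIntegrable_drift hγ hm (fun _ => hr) hindep] with ω h
    rw [← intervalIntegral.integral_of_le hst',
      ← intervalIntegral.integral_interval_sub_left (h t) (h s), compensated, compensated]
    ring
  have hdrift : ∫ ω in A, (∫ u in Set.Ioc (s : ℝ) t, drift γ (fun _ => r) u.toNNReal ω) ∂P =
      ((t : ℝ) - s) / ((r : ℝ) - s) * c := by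
    -- The endpoint is dropped because `setIntegral_drift` requires `u < r`, while `t = r` is
    -- allowed.
    rw [integral_integral_swap hI', integral_Ioc_eq_integral_Ioo,
      setIntegral_congr_fun (g := fun _ => c / ((r : ℝ) - s)) measurableSet_Ioo]
    · rw [setIntegral_const, measureReal_def, Real.volume_Ioo,
        ENNReal.toReal_ofReal (by linarith), smul_eq_mul]
      ring
    · intro u hu
      have hu0 : 0 ≤ u := s.coe_nonneg.trans hu.1.le
      have h1 : s ≤ u.toNNReal := NNReal.le_toNNReal_of_coe_le hu.1.le
      have h2 : u.toNNReal < r := by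
        rw [Real.toNNReal_lt_iff_lt_coe hu0]
        exact hu.2.trans_le htr
      simp only [hc, hA]
      exact setIntegral_drift hγ h1 h2 hS
  have hb := fun u => (integrable_bridge hγ hm u).integrableOn (s := A)
  have hbts : Integrable (fun ω => bridge γ (fun _ => r) t ω - bridge γ (fun _ => r) s ω)
    (P.restrict A) := (hb t).sub (hb s)
  rw [← hA, integral_congr_ae e, integral_sub hbts hI'.integral_prod_left, hdrift,
    hA, setIntegral_bridge_sub hγ hsr hst htr hS, ← hA, ← hc, sub_self]

/-! ### The enlarged filtration and the martingale property -/

section Filtration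

variable {Ω : Type*} [mΩ : MeasurableSpace Ω] {P : Measure Ω} {γ : ℝ≥0 → Ω → ℝ} {τ : Ω → ℝ≥0}

/-- `rcVersion` samples times to the right of `v`; capping them at `t` keeps the version measurable
with respect to the information at time `t`. -/
theorem ae_continuousWithinAt_bridge (hγ : IsStandardGammaProcess γ P) (τ : Ω → ℝ≥0) :
    ∀ᵐ ω ∂P, ∀ t v : ℝ≥0,
      ContinuousWithinAt (fun u => bridge γ τ (min u t) ω) (Set.Ici v) v := by
  filter_upwards [hγ.right_continuous] with ω h t v
  have hmin : ContinuousWithinAt (fun u : ℝ≥0 => min (min u t) (τ ω)) (Set.Ici v) v :=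
    ((continuous_id.min continuous_const).min continuous_const).continuousWithinAt
  refine ContinuousWithinAt.div_const ?_ _
  exact (h (min (min v t) (τ ω))).comp (f := fun u : ℝ≥0 => min (min u t) (τ ω)) hmin fun u hu =>
    Set.mem_Ici.2 (min_le_min_right _ (min_le_min_right _ (Set.mem_Ici.1 hu)))

variable [P.IsComplete]

theorem enlargedFiltration_apply (hγ : IsStandardGammaProcess γ P) (hτ : Measurable τ) (s : ℝ≥0) :
    enlargedFiltration hγ hτ s =
      (MeasurableSpace.comap (fun ω (v : Set.Iic s) => bridge γ τ v ω) inferInstance ⊔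
        MeasurableSpace.generateFrom {A : Set Ω | P A = 0}) ⊔
        MeasurableSpace.comap τ inferInstance := by
  rw [← Filtration.natural_eq_comap (bridge γ τ)
    fun t => (measurable_bridge hγ hτ t).stronglyMeasurable]
  rfl

theorem measurableSet_of_null (hγ : IsStandardGammaProcess γ P) (hτ : Measurable τ) (s : ℝ≥0)
    {A : Set Ω} (hA : P A = 0) : MeasurableSet[enlargedFiltration hγ hτ s] A := by
  rw [enlargedFiltration_apply]
  exact (le_sup_right.trans le_sup_left :
    MeasurableSpace.generateFrom {A : Set Ω | P A = 0} ≤ _) _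
    (MeasurableSpace.measurableSet_generateFrom hA)

theorem measurable_time_enlargedFiltration (hγ : IsStandardGammaProcess γ P) (hτ : Measurable τ)
    (s : ℝ≥0) : Measurable[enlargedFiltration hγ hτ s] τ := by
  rw [enlargedFiltration_apply]
  exact (comap_measurable τ).mono le_sup_right le_rfl

theorem measurable_bridge_enlargedFiltration (hγ : IsStandardGammaProcess γ P)
    (hτ : Measurable τ) {u s : ℝ≥0} (hus : u ≤ s) :
    Measurable[enlargedFiltration hγ hτ s] (bridge γ τ u) := by
  rw [enlargedFiltration_apply]
  have h : Measurable[MeasurableSpace.comap (fun ω (v : Set.Iic s) => bridge γ τ v ω) inferInstance]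
      (bridge γ τ u) :=
    Measurable.comp (g := fun x : Set.Iic s → ℝ => x ⟨u, hus⟩) (measurable_pi_apply _)
      (comap_measurable _)
  exact h.mono (le_sup_left.trans le_sup_left) le_rfl

theorem measurable_enlargedFiltration_congr (hγ : IsStandardGammaProcess γ P) (hτ : Measurable τ)
    {s : ℝ≥0} {f g : Ω → ℝ} (hg : Measurable[enlargedFiltration hγ hτ s] g) (hfg : f =ᵐ[P] g) :
    Measurable[enlargedFiltration hγ hτ s] f := by
  intro B hB
  have h0 : P {ω | f ω ≠ g ω} = 0 := ae_iff.1 hfg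
  have h1 : P (g ⁻¹' B \ f ⁻¹' B) = 0 := measure_mono_null (fun ω hω =>
    show f ω ≠ g ω from fun h => hω.2 (by rw [Set.mem_preimage, h]; exact hω.1)) h0
  have h2 : P (f ⁻¹' B \ g ⁻¹' B) = 0 := measure_mono_null (fun ω hω =>
    show f ω ≠ g ω from fun h => hω.2 (by rw [Set.mem_preimage, ← h]; exact hω.1)) h0
  have e : f ⁻¹' B = (g ⁻¹' B \ (g ⁻¹' B \ f ⁻¹' B)) ∪ (f ⁻¹' B \ g ⁻¹' B) := by
    ext ω
    by_cases hf : ω ∈ f ⁻¹' B <;> by_cases hg : ω ∈ g ⁻¹' B <;> simp_all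
  rw [e]
  exact ((hg hB).diff (measurableSet_of_null hγ hτ s h1)).union (measurableSet_of_null hγ hτ s h2)

/-- Every event of the enlarged filtration is, up to a null set, an event about the path of the
bridge and its length. -/
theorem exists_ae_eq_of_measurableSet (hγ : IsStandardGammaProcess γ P) (hτ : Measurable τ)
    {s : ℝ≥0} {A : Set Ω} (hA : MeasurableSet[enlargedFiltration hγ hτ s] A) :
    ∃ S : Set ((Set.Iic s → ℝ) × ℝ≥0), MeasurableSet S ∧
      A =ᵐ[P] {ω | ((fun v : Set.Iic s => bridge γ τ v ω), τ ω) ∈ S} := by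
  -- Sets almost surely equal to an event of the bridge path and `τ` form a σ-algebra, so only the
  -- three generating families need checking.
  have hle : enlargedFiltration hγ hτ s ≤ eventuallyMeasurableSpace
      (MeasurableSpace.comap (fun ω => ((fun v : Set.Iic s => bridge γ τ v ω), τ ω)) inferInstance)
      (ae P) := by
    rw [enlargedFiltration_apply]
    have hc := comap_measurable (m := inferInstance)
      fun ω => ((fun v : Set.Iic s => bridge γ τ v ω), τ ω)
    refine sup_le (sup_le ?_ (MeasurableSpace.generateFrom_le fun B hB => ?_)) ?_
    · exact (measurable_iff_comap_le.1 (measurable_fst.comp hc)).trans le_eventuallyMeasurableSpace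
    · exact ⟨∅, @MeasurableSet.empty _ (_), ae_eq_empty.2 hB⟩
    · exact (measurable_iff_comap_le.1 (measurable_snd.comp hc)).trans le_eventuallyMeasurableSpace
  obtain ⟨_, ⟨S, hS, rfl⟩, h⟩ := hle A hA
  exact ⟨S, hS, h⟩

theorem isStoppingTime_enlargedFiltration (hγ : IsStandardGammaProcess γ P) (hτ : Measurable τ) :
    IsStoppingTime (enlargedFiltration hγ hτ) (fun ω => (τ ω : WithTop ℝ≥0)) := fun t => by
  simp only [WithTop.coe_le_coe]
  exact measurable_time_enlargedFiltration hγ hτ t measurableSet_Iic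

/-- The drift is rebuilt from the capped version of the bridge, jointly measurable for the σ-algebra
at time `t`. Its integral is then measurable there, and agrees almost surely with the original. -/
theorem measurable_compensated_enlargedFiltration (hγ : IsStandardGammaProcess γ P)
    (hτ : Measurable τ) (t : ℝ≥0) :
    Measurable[enlargedFiltration hγ hτ t] (compensated γ τ t) := by
  have hb := measurable_bridge_enlargedFiltration hγ hτ (le_refl t)
  have hτm := measurable_time_enlargedFiltration hγ hτ t
  have hX := @measurable_rcVersion Ω (enlargedFiltration hγ hτ t)
    (fun u => bridge γ τ (min u t)) fun u =>
      measurable_bridge_enlargedFiltration hγ hτ (min_le_right u t)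
  obtain ⟨X, hXe⟩ : ∃ X, X = rcVersion fun u => bridge γ τ (min u t) := ⟨_, rfl⟩
  rw [← hXe] at hX
  have hZ : Measurable[(enlargedFiltration hγ hτ t).prod inferInstance] fun p : Ω × ℝ =>
      if p.2.toNNReal < τ p.1 then (1 - X p.2.toNNReal p.1) / ((τ p.1 : ℝ) - p.2.toNNReal)
      else 0 := by
    have h1 : Measurable[(enlargedFiltration hγ hτ t).prod inferInstance]
        fun p : Ω × ℝ => p.2.toNNReal :=
      measurable_real_toNNReal.comp (@measurable_snd _ _ (enlargedFiltration hγ hτ t) _)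
    have h2 : Measurable[(enlargedFiltration hγ hτ t).prod inferInstance]
        fun p : Ω × ℝ => τ p.1 :=
      hτm.comp (@measurable_fst _ _ (enlargedFiltration hγ hτ t) _)
    have h3 : Measurable[(enlargedFiltration hγ hτ t).prod inferInstance]
        fun p : Ω × ℝ => X p.2.toNNReal p.1 :=
      hX.comp (h1.prodMk (@measurable_fst _ _ (enlargedFiltration hγ hτ t) _))
    exact Measurable.ite (measurableSet_lt h1 h2)
      ((h3.const_sub 1).div (h2.coe_nnreal_real.sub h1.coe_nnreal_real)) measurable_const
  have hI : Measurable[enlargedFiltration hγ hτ t] fun ω => ∫ s in Set.Ioc 0 (t : ℝ),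
      if s.toNNReal < τ ω then (1 - X s.toNNReal ω) / ((τ ω : ℝ) - s.toNNReal) else 0 :=
    (@StronglyMeasurable.integral_prod_right' _ _ _ (enlargedFiltration hγ hτ t) _ _ _ _ _ _
      hZ.stronglyMeasurable).measurable
  refine measurable_enlargedFiltration_congr hγ hτ (hb.sub hI) ?_
  filter_upwards [ae_continuousWithinAt_bridge hγ τ] with ω h
  rw [compensated, intervalIntegral.integral_of_le t.coe_nonneg, Pi.sub_apply]
  congr 1
  refine setIntegral_congr_fun measurableSet_Ioc fun s hs => ?_
  have hst : s.toNNReal ≤ t := Real.toNNReal_le_iff_le_coe.2 hs.2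
  simp only [drift, hXe]
  rw [rcVersion_eq (h t _), min_eq_left hst]

theorem martingale_compensated [IsProbabilityMeasure P] (hγ : IsStandardGammaProcess γ P)
    (hτ : Measurable τ) (hτ_pos : ∀ ω, 0 < τ ω) (hindep : IndepFun τ (fun ω t => γ t ω) P) :
    Martingale (compensated γ τ) (enlargedFiltration hγ hτ) P := by
  have hint := integrable_compensated hγ hτ hτ_pos hindep
  have hmeas := fun t => (measurable_compensated_enlargedFiltration hγ hτ t).stronglyMeasurable
  refine ⟨hmeas, fun s t hst => ?_⟩
  refine (ae_eq_condExp_of_forall_setIntegral_eq ((enlargedFiltration hγ hτ).le s) (hint t)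
    (fun _ _ _ => (hint s).integrableOn) (fun A hA _ => ?_)
    (hmeas s).aestronglyMeasurable).symm
  obtain ⟨S, hS, hAS⟩ := exists_ae_eq_of_measurableSet hγ hτ hA
  have hAm : MeasurableSet A := (enlargedFiltration hγ hτ).le s A hA
  symm
  rw [← sub_eq_zero, ← integral_sub (hint t).integrableOn (hint s).integrableOn,
    ← integral_indicator hAm]
  -- `T` and `Φ` copy the event and the integrand to the space of lengths and paths, where the law
  -- is a product.
  obtain ⟨T, hT⟩ : ∃ T : Set (ℝ≥0 × (ℝ≥0 → ℝ)),
    T = {p | ((fun v : Set.Iic s => bridge pathEval Prod.fst v p), p.1) ∈ S} := ⟨_, rfl⟩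
  have hTm : MeasurableSet T := by
    rw [hT]
    exact ((measurable_pi_lambda _ fun v : Set.Iic s =>
      (measurable_uncurry_bridge measurable_pathEval measurable_fst).comp
        (measurable_const.prodMk measurable_id)).prodMk measurable_fst : Measurable _) hS
  obtain ⟨Φ, hΦ⟩ : ∃ Φ : ℝ≥0 × (ℝ≥0 → ℝ) → ℝ, Φ = T.indicator fun p =>
    compensated pathEval Prod.fst t p - compensated pathEval Prod.fst s p := ⟨_, rfl⟩
  have hΦm : Measurable Φ := by
    rw [hΦ]
    exact ((measurable_compensated measurable_pathEval measurable_fst t).sub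
      (measurable_compensated measurable_pathEval measurable_fst s)).indicator hTm
  have e : (A.indicator fun ω => compensated γ τ t ω - compensated γ τ s ω) =ᵐ[P]
      fun ω => Φ (τ ω, fun t => γ t ω) := by
    filter_upwards [ae_pathEval_eq hγ, hAS.mem_iff] with ω h hω
    have h' : ∀ v, γ v ω = pathEval v (τ ω, fun t => γ t ω) := fun v => (h _ v).symm
    rw [hΦ]
    refine indicator_apply_congr ?_ ?_
    · rw [hω, hT]
      simp only [Set.mem_ofPred_eq]
      simp only [bridge_congr (σ := τ) (ρ := Prod.fst) h' rfl]
    · simp only [compensated_congr (σ := τ) (ρ := Prod.fst) h' rfl]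
  rw [integral_congr_ae e]
  refine integral_time_path_eq_zero hγ hτ hτ_pos hindep hΦm
    ((((hint t).sub (hint s)).indicator hAm).congr e) fun r hr => ?_
  -- Once the length is frozen at `r`, the event becomes the section of `S` at `r`, an event of the
  -- bridge path alone.
  have hSr : MeasurableSet {x : Set.Iic s → ℝ | (x, r) ∈ S} := measurable_prodMk_right hS
  have hm : Measurable fun _ : Ω => r := measurable_const
  rw [← setIntegral_compensated_sub_const hγ hr hst hSr, ← integral_indicator]
  · refine integral_congr_ae ?_
    filter_upwards [ae_pathEval_eq hγ] with ω h
    rw [hΦ]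
    refine indicator_apply_congr ?_ ?_
    · rw [hT]
      simp only [Set.mem_ofPred_eq]
      simp only [bridge_congr (σ := Prod.fst) (ρ := fun _ : Ω => r) (h r) rfl]
    · simp only [compensated_congr (σ := Prod.fst) (ρ := fun _ : Ω => r) (h r) rfl]
  · exact (measurable_pi_lambda _ fun v : Set.Iic s => measurable_bridge hγ hm v :
      Measurable _) hSr

end Filtration
end GammaBridge

theorem mainTheorem6 {Ω : Type*} [MeasurableSpace Ω] (P : Measure Ω)
    [IsProbabilityMeasure P] [P.IsComplete]
    (γ : ℝ≥0 → Ω → ℝ) (hγ : GammaBridge.IsStandardGammaProcess γ P)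
    (τ : Ω → ℝ≥0) (hτ : Measurable τ) (hτ_pos : ∀ ω, 0 < τ ω)
    (hindep : IndepFun τ (fun ω t => γ t ω) P) :
    (∀ t : ℝ≥0,
      Integrable (fun p : Ω × ℝ => GammaBridge.drift γ τ p.2.toNNReal p.1)
        (P.prod (volume.restrict (Set.Ioc 0 (t : ℝ)))) ∧
      ∫⁻ ω, (∫⁻ s in Set.Ioc 0 (t : ℝ),
        ENNReal.ofReal |GammaBridge.drift γ τ s.toNNReal ω|) ∂P ≤ 1) ∧
    (∀ᵐ ω ∂P, ∀ t : ℝ≥0,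
      IntervalIntegrable (fun s : ℝ => GammaBridge.drift γ τ s.toNNReal ω) volume 0 t) ∧
    IsStoppingTime (GammaBridge.enlargedFiltration hγ hτ) (fun ω => (τ ω : WithTop ℝ≥0)) ∧
    Martingale (GammaBridge.compensated γ τ) (GammaBridge.enlargedFiltration hγ hτ) P ∧
    stoppedProcess (GammaBridge.compensated γ τ) (fun ω => (τ ω : WithTop ℝ≥0)) =
      GammaBridge.compensated γ τ :=
  ⟨fun t => ⟨GammaBridge.integrable_drift hγ hτ hτ_pos hindep t,
      GammaBridge.lintegral_lintegral_drift_le_one hγ hτ hτ_pos hindep t⟩,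
    GammaBridge.ae_intervalIntegrable_drift hγ hτ hτ_pos hindep,
    GammaBridge.isStoppingTime_enlargedFiltration hγ hτ,
    GammaBridge.martingale_compensated hγ hτ hτ_pos hindep,
    GammaBridge.stoppedProcess_compensated γ τ⟩
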